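/- Let $K$ be a field. For a lattice $L$ let $K[L]$ be the polynomial ring whose variables are the elements of $L$, let $I_L\subseteq K[L]$ be the ideal generated by the binomials $ab-(a\vee b)(a\wedge b)$ with $a,b\in L$ incomparable, and let $H[L]=K[L]/I_L$, with the standard grading in which every $a\in L$ has degree $1$; let $\mathfrak m$ be its maximal graded ideal. A collection $\mathcal F$ of ideals of $H[L]$ is a Koszul filtration if: (1) every ideal in $\mathcal F$ is generated by linear forms; (2) $0\in\mathcal F$ and $\mathfrak m\in\mathcal F$; (3) for every $0\neq I\in\mathcal F$ there is $J\in\mathcal F$ with $J\subsetneq I$, $I/J$ cyclic and $J:I\in\mathcal F$. It is combinatorial if moreover every ideal in $\mathcal F$ is generated by the residue classes of some elements of $L$. (a) If $L$ is a finite modular lattice, then $L$ is distributive if and only if $H[L]$ admits a combinatorial Koszul filtration. (b) Modularity cannot be dropped: let $P=\{e,x,y,z,f\}$ be the pentagon lattice, with $e<y<x<f$, $e<z<f$ and $z$ incomparable to $x$ and $y$. Then $P$ is not distributive, but $H[P]$ admits a combinatorial Koszul filtration. -/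

import Mathlib

/-- The distributive laws for a lattice (as a property, both laws). -/
def IsDistributiveLattice (L : Type*) [Lattice L] : Prop :=
  ∀ x y z : L, x ⊓ (y ⊔ z) = (x ⊓ y) ⊔ (x ⊓ z) ∧ x ⊔ (y ⊓ z) = (x ⊔ y) ⊓ (x ⊔ z)

/-- The join-meet ideal `I_L` of the polynomial ring `K[L]`: it is generated by the basic
binomials `a b - (a ⊔ b) (a ⊓ b)` with `a, b` incomparable. -/
noncomputable def joinMeetIdeal (K L : Type*) [Field K] [Lattice L] : Ideal (MvPolynomial L K) :=
  Ideal.span {p | ∃ a b : L, IncompRel (· ≤ ·) a b ∧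
    p = MvPolynomial.X a * MvPolynomial.X b - MvPolynomial.X (a ⊔ b) * MvPolynomial.X (a ⊓ b)}

/-- The algebra `H[L] = K[L] / I_L`. -/
abbrev LatticeAlgebra (K L : Type*) [Field K] [Lattice L] : Type _ :=
  MvPolynomial L K ⧸ joinMeetIdeal K L

/-- The residue class in `H[L]` of the variable `a ∈ L`. -/
noncomputable def latticeVar (K : Type*) {L : Type*} [Field K] [Lattice L] (a : L) : LatticeAlgebra K L :=
  Ideal.Quotient.mk (joinMeetIdeal K L) (MvPolynomial.X a)

/-- The standard grading of `H[L]`, in which every variable has degree one: the degree `i` part is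
the image of the homogeneous polynomials of degree `i`. -/
noncomputable def latticeGrading (K L : Type*) [Field K] [Lattice L] (i : ℕ) :
    Submodule K (LatticeAlgebra K L) :=
  (MvPolynomial.homogeneousSubmodule L K i).map
    (Ideal.Quotient.mkₐ K (joinMeetIdeal K L)).toLinearMap

/-- A collection `F` of ideals of a standard graded `K`-algebra `R = ⨁ i, 𝒜 i` is a Koszul
filtration. The maximal graded ideal is the ideal generated by all homogeneous elements of positive
degree, and `I / J` is the image of `I` in `R / J`. -/
structure IsKoszulFiltration {K R : Type*} [Field K] [CommRing R] [Algebra K R]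
    (𝒜 : ℕ → Submodule K R) (F : Set (Ideal R)) : Prop where
  linear : ∀ I ∈ F, ∃ S : Set R, S ⊆ (𝒜 1 : Set R) ∧ I = Ideal.span S
  bot_mem : (⊥ : Ideal R) ∈ F
  maximal_mem : Ideal.span {r : R | ∃ i : ℕ, 0 < i ∧ r ∈ 𝒜 i} ∈ F
  exists_colon : ∀ I ∈ F, I ≠ ⊥ → ∃ J ∈ F, J < I ∧
    (Submodule.map (Submodule.mkQ J) I).IsPrincipal ∧ Submodule.colon J (I : Set R) ∈ F

/-- A combinatorial Koszul filtration of `H[L]`: a Koszul filtration each of whose ideals is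
generated by the residue classes of some elements of `L`. -/
def IsCombinatorialKoszulFiltration (K : Type*) {L : Type*} [Field K] [Lattice L]
    (F : Set (Ideal (LatticeAlgebra K L))) : Prop :=
  IsKoszulFiltration (latticeGrading K L) F ∧
    ∀ I ∈ F, ∃ S : Set L, I = Ideal.span (latticeVar K '' S)

/-- The underlying set of the pentagon lattice: `e < y < x < f` and `e < z < f`, with `z`
incomparable to `x` and to `y`. -/
inductive Pentagon : Type
  | e
  | x
  | y
  | z
  | f

namespace Pentagon

/-- The order of the pentagon. -/
def le : Pentagon → Pentagon → Prop
  | e, _ => True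
  | _, f => True
  | x, x => True
  | y, y => True
  | y, x => True
  | z, z => True
  | _, _ => False

/-- The join of the pentagon. -/
def sup : Pentagon → Pentagon → Pentagon
  | e, b => b
  | a, e => a
  | x, x => x
  | x, y => x
  | y, x => x
  | y, y => y
  | z, z => z
  | _, _ => f

/-- The meet of the pentagon. -/
def inf : Pentagon → Pentagon → Pentagon
  | f, b => b
  | a, f => a
  | x, x => x
  | x, y => y
  | y, x => y
  | y, y => y
  | z, z => z
  | _, _ => e

instance instLattice : Lattice Pentagon where
  le := le
  le_refl a := by cases a <;> trivial
  le_trans a b c := by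
    cases a <;> cases b <;> cases c <;> simp [le]
  le_antisymm a b := by
    cases a <;> cases b <;> simp [le]
  sup := sup
  inf := inf
  le_sup_left a b := by cases a <;> cases b <;> trivial
  le_sup_right a b := by cases a <;> cases b <;> trivial
  sup_le a b c := by
    cases a <;> cases b <;> cases c <;> simp [le, sup]
  inf_le_left a b := by cases a <;> cases b <;> trivial
  inf_le_right a b := by cases a <;> cases b <;> trivial
  le_inf a b c := by
    cases a <;> cases b <;> cases c <;> simp [le, inf]

end Pentagon

/-!
Write `(S)` for the ideal of `H[L]` generated by the variables in `S` (`varIdeal`). A family of such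
ideals is a combinatorial Koszul filtration once every nonempty member `S` loses a variable `a` to
another member `T` with `(T) : a` again in the family
(`LatticeAlgebra.isCombinatorialKoszulFiltration_of_sets`).

**Distributive lattices.** The filtration consists of the ideals `(T)` with `T` a lower set. For `a`
minimal outside `T` one has `(T) : a = (b | a ≰ b)`: such a `b` satisfies `a b = (a ⊔ b) (a ⊓ b)`
with `a ⊓ b ∈ T`. Conversely, monomials straighten to monomials of chains
(`LatticeAlgebra.exists_chain`), so modulo these `b` every element is a combination of chains above
`a`. The toric representation `LatticeAlgebra.toricHom`, given by prime filters and their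
complements, sends distinct chains to distinct monomials
(`LatticeAlgebra.sum_toricExponent_injOn`) and detects the least element of a chain, so
multiplication by `a` sends no nonzero such combination into `(T)`.

**Modular lattices that are not distributive.** Such a lattice contains a diamond
`e ⋖ x, y, z ⋖ f` (`exists_covBy_isDiamond`). Given a combinatorial Koszul filtration, take a member
`I` minimal among those that contain a variable `u ∈ [e, f]`, and `J` as in the filtration axiom; then
`I = J + (u)` because `I / J` is cyclic (`LatticeAlgebra.eq_of_isPrincipal`), and `J` contains no
variable of `[e, f]`. Let `J : I = (S)`. If `S` contained some `s ∈ [e, f]`, then `s u ∈ J`, which is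
impossible, because sending the variables in `[e, f]` to `1` and the others to `0` defines a
homomorphism `H[L] → K` (`LatticeAlgebra.intervalHom`) that kills `J` but not `s u`. But `(S)`
contains the annihilator of `u`, and this forces such an `s` into `S`: one has `e f (x - y) = 0`, and
if `u ≠ e, f`, then `u` is complementary to two of `x, y, z`, whose difference it kills
(`LatticeAlgebra.exists_mem_Icc_of_annihilator`).

**The pentagon.** The filtration consists of `0` and all `(S)` with `x ∈ S`. The variable `x` is a
nonzerodivisor (`Pentagon.eq_zero_of_mul_latticeVar_x`), and modulo `x` the relations become the
monomials `e f` and `y z`, so that all colon ideals are again generated by variables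
(`Pentagon.mul_latticeVar_mem_varIdeal_iff`).
-/

/-! ### Ideals generated by variables and homomorphisms out of `H[L]` -/

/-- The ideal of `H[L]` generated by the residue classes of the elements of `S`. -/
noncomputable def varIdeal (K : Type*) {L : Type*} [Field K] [Lattice L] (S : Set L) :
    Ideal (LatticeAlgebra K L) :=
  Ideal.span (latticeVar K '' S)

namespace LatticeAlgebra

section Basic

variable {K L : Type*} [Field K] [Lattice L]

lemma latticeVar_mul (a b : L) :
    latticeVar K a * latticeVar K b = latticeVar K (a ⊔ b) * latticeVar K (a ⊓ b) := by
  by_cases hab : a ≤ b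
  · rw [sup_eq_right.2 hab, inf_eq_left.2 hab, mul_comm]
  by_cases hba : b ≤ a
  · rw [sup_eq_left.2 hba, inf_eq_right.2 hba]
  · simp only [latticeVar, ← map_mul]
    exact Ideal.Quotient.eq.2 (Ideal.subset_span ⟨a, b, ⟨hab, hba⟩, rfl⟩)

/-- The universal property of `H[L]`: a map `v` on `L` that satisfies the join-meet relations
extends to an algebra homomorphism. -/
noncomputable def lift {A : Type*} [CommRing A] [Algebra K A] (v : L → A)
    (hv : ∀ a b, IncompRel (· ≤ ·) a b → v a * v b = v (a ⊔ b) * v (a ⊓ b)) :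
    LatticeAlgebra K L →ₐ[K] A :=
  Ideal.Quotient.liftₐ _ (MvPolynomial.aeval v) fun p hp => by
    have : joinMeetIdeal K L ≤ RingHom.ker (MvPolynomial.aeval (R := K) v) := by
      refine Ideal.span_le.2 ?_
      rintro _ ⟨a, b, hab, rfl⟩
      simp [RingHom.mem_ker, hv a b hab]
    exact this hp

@[simp]
lemma lift_latticeVar {A : Type*} [CommRing A] [Algebra K A] (v : L → A)
    (hv : ∀ a b, IncompRel (· ≤ ·) a b → v a * v b = v (a ⊔ b) * v (a ⊓ b)) (a : L) :
    lift (K := K) v hv (latticeVar K a) = v a := by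
  simp only [lift, latticeVar]
  exact MvPolynomial.aeval_X v a

open Classical in
/-- The point of `Spec H[L]` attached to the interval `[e, f]`: every variable in the interval is
sent to `1` and every other variable to `0`. This respects the relations because `[e, f]` is a
convex sublattice. -/
noncomputable def intervalHom (K : Type*) {L : Type*} [Field K] [Lattice L] (e f : L) :
    LatticeAlgebra K L →ₐ[K] K :=
  lift (fun a => if a ∈ Set.Icc e f then 1 else 0) fun a b _ => by
    have : (a ∈ Set.Icc e f ∧ b ∈ Set.Icc e f) ↔ (a ⊔ b ∈ Set.Icc e f ∧ a ⊓ b ∈ Set.Icc e f) := by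
      simp only [Set.mem_Icc, le_inf_iff, sup_le_iff]
      constructor
      · rintro ⟨⟨h1, h2⟩, h3, h4⟩
        exact ⟨⟨h1.trans le_sup_left, h2, h4⟩, ⟨h1, h3⟩, inf_le_left.trans h2⟩
      · rintro ⟨⟨-, h2, h4⟩, ⟨h1, h3⟩, -⟩
        exact ⟨⟨h1, h2⟩, h3, h4⟩
    simp only [← ite_and, mul_ite, mul_one, mul_zero]
    congr 1
    rw [and_comm, eq_iff_iff, this, and_comm]

open Classical in
@[simp]
lemma intervalHom_latticeVar (e f a : L) :
    intervalHom K e f (latticeVar K a) = if a ∈ Set.Icc e f then 1 else 0 := by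
  simp [intervalHom]

open Classical in
/-- The homomorphism to the dual numbers that sends the variable `a` to `ε` and the other variables
to `0`. It records the constant term of an element of `H[L]` and the coefficient of `a` in its
linear part; the relations, being quadratic, impose nothing. -/
noncomputable def dualHom (K : Type*) {L : Type*} [Field K] [Lattice L] (a : L) :
    LatticeAlgebra K L →ₐ[K] DualNumber K :=
  lift (fun b => if b = a then DualNumber.eps else 0) fun b c _ => by
    split_ifs <;> simp

open Classical in
@[simp]
lemma dualHom_latticeVar (a b : L) :
    dualHom K a (latticeVar K b) = if b = a then DualNumber.eps else 0 := by
  simp [dualHom]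

lemma map_eq_zero_of_mem_varIdeal {A : Type*} [CommRing A] [Algebra K A]
    (φ : LatticeAlgebra K L →ₐ[K] A) {S : Set L} (hS : ∀ s ∈ S, φ (latticeVar K s) = 0)
    {p : LatticeAlgebra K L} (hp : p ∈ varIdeal K S) : φ p = 0 := by
  have : varIdeal K S ≤ RingHom.ker φ := by
    refine Ideal.span_le.2 ?_
    rintro _ ⟨s, hs, rfl⟩
    exact hS s hs
  exact this hp

lemma latticeVar_mem_varIdeal {S : Set L} {a : L} (ha : a ∈ S) : latticeVar K a ∈ varIdeal K S :=
  Ideal.subset_span ⟨a, ha, rfl⟩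

lemma latticeVar_mem_varIdeal_iff {S : Set L} {a : L} :
    latticeVar K a ∈ varIdeal K S ↔ a ∈ S := by
  refine ⟨fun h => ?_, latticeVar_mem_varIdeal⟩
  by_contra ha
  have := map_eq_zero_of_mem_varIdeal (dualHom K a) (fun s hs => by
    have : s ≠ a := fun h => ha (h ▸ hs)
    simp [this]) h
  have := congrArg TrivSqZeroExt.snd this
  simp at this

lemma varIdeal_empty : varIdeal K (∅ : Set L) = ⊥ := by simp [varIdeal]

lemma varIdeal_insert (a : L) (S : Set L) :
    varIdeal K (insert a S) = Ideal.span {latticeVar K a} ⊔ varIdeal K S := by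
  rw [varIdeal, Set.image_insert_eq, Ideal.span_insert]; rfl

lemma latticeVar_mem_latticeGrading_one (a : L) :
    latticeVar K a ∈ latticeGrading K L 1 :=
  ⟨MvPolynomial.X a, MvPolynomial.isHomogeneous_X K a, rfl⟩

lemma span_positive_degree_eq :
    Ideal.span {r : LatticeAlgebra K L | ∃ i : ℕ, 0 < i ∧ r ∈ latticeGrading K L i} =
      varIdeal K Set.univ := by
  refine le_antisymm (Ideal.span_le.2 ?_) (Ideal.span_mono ?_)
  · rintro _ ⟨i, hi, p, hp, rfl⟩
    have hp' : p ∈ Ideal.span (MvPolynomial.X '' (Set.univ : Set L)) := by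
      rw [MvPolynomial.mem_ideal_span_X_image]
      intro m hm
      have hd : m.degree = i := by
        have := hp (MvPolynomial.mem_support_iff.1 hm)
        rw [Finsupp.degree_eq_weight_one]
        exact this
      by_contra! h
      have : m = 0 := Finsupp.ext fun a => h a trivial
      rw [this, map_zero] at hd
      omega
    have := Ideal.mem_map_of_mem (Ideal.Quotient.mk (joinMeetIdeal K L)) hp'
    rw [Ideal.map_span, ← Set.image_comp] at this
    exact this
  · rintro _ ⟨a, -, rfl⟩
    exact ⟨1, one_pos, latticeVar_mem_latticeGrading_one a⟩

lemma mem_colon_varIdeal_insert {a : L} {S : Set L} {g : LatticeAlgebra K L} :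
    g ∈ Submodule.colon (varIdeal K S) (varIdeal K (insert a S) : Set (LatticeAlgebra K L)) ↔
      g * latticeVar K a ∈ varIdeal K S := by
  rw [Submodule.mem_colon]
  refine ⟨fun h => h _ (latticeVar_mem_varIdeal (Set.mem_insert _ _)), fun h p hp => ?_⟩
  rw [SetLike.mem_coe, varIdeal_insert, Submodule.mem_sup] at hp
  obtain ⟨q, hq, r, hr, rfl⟩ := hp
  obtain ⟨c, rfl⟩ := Ideal.mem_span_singleton'.1 hq
  rw [smul_eq_mul, mul_add]
  refine add_mem ?_ (Ideal.mul_mem_left _ _ hr)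
  rw [mul_left_comm]
  exact Ideal.mul_mem_left _ _ h

/-- A criterion for a combinatorial Koszul filtration in terms of the generating sets of variables
only: each nonempty set of the family loses one variable `a` to another set `T` of the family, and
the colon ideal `(T) : a` is generated by a third one. -/
lemma isCombinatorialKoszulFiltration_of_sets (𝒮 : Set (Set L)) (h0 : ∅ ∈ 𝒮) (h1 : Set.univ ∈ 𝒮)
    (h : ∀ S ∈ 𝒮, S.Nonempty → ∃ a, ∃ T ∈ 𝒮, ∃ U ∈ 𝒮, a ∉ T ∧ S = insert a T ∧
      ∀ g, g * latticeVar K a ∈ varIdeal K T ↔ g ∈ varIdeal K U) :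
    IsCombinatorialKoszulFiltration K (varIdeal K '' 𝒮) := by
  refine ⟨⟨?_, ⟨∅, h0, varIdeal_empty⟩, ⟨_, h1, span_positive_degree_eq.symm⟩, ?_⟩, ?_⟩
  · rintro _ ⟨S, -, rfl⟩
    refine ⟨latticeVar K '' S, ?_, rfl⟩
    rintro _ ⟨a, -, rfl⟩
    exact latticeVar_mem_latticeGrading_one a
  · rintro _ ⟨S, hS, rfl⟩ hne
    have hS' : S.Nonempty := by
      rw [Set.nonempty_iff_ne_empty]
      rintro rfl
      exact hne varIdeal_empty
    obtain ⟨a, T, hT, U, hU, haT, rfl, hcol⟩ := h S hS hS'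
    refine ⟨_, ⟨T, hT, rfl⟩, ?_, ?_, U, hU, ?_⟩
    · refine lt_of_le_of_ne (Ideal.span_mono (Set.image_mono (Set.subset_insert _ _))) fun he => ?_
      exact haT (latticeVar_mem_varIdeal_iff.1 (he ▸ latticeVar_mem_varIdeal (Set.mem_insert a T)))
    · refine ⟨⟨(varIdeal K T).mkQ (latticeVar K a), ?_⟩⟩
      rw [varIdeal_insert, Submodule.map_sup, Submodule.mkQ_map_self, sup_bot_eq, Ideal.span,
        Submodule.map_span, Set.image_singleton]
    · ext g
      rw [mem_colon_varIdeal_insert, hcol]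
  · rintro _ ⟨S, -, rfl⟩
    exact ⟨S, rfl⟩

end Basic

end LatticeAlgebra

/-! ### Distributive lattices: straightening and the toric representation -/

namespace LatticeAlgebra

section Distributive

variable {K L : Type*} [Field K] [Lattice L]

/-- Inserting `a` into a chain with least element `c` splits off `a ⊓ c` and leaves `a ⊔ c` to be
inserted into the rest. -/
lemma exists_chain_insert (l : List L) (hl : l.Pairwise (· ≤ ·)) (a : L) :
    ∃ l' : List L, l'.Pairwise (· ≤ ·) ∧
      latticeVar K a * (l.map (latticeVar K)).prod = (l'.map (latticeVar K)).prod ∧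
      ∀ x, x ≤ a → (∀ c ∈ l, x ≤ c) → ∀ c ∈ l', x ≤ c := by
  induction l generalizing a with
  | nil => exact ⟨[a], by simp, by simp, by simp +contextual⟩
  | cons c l ih =>
    rw [List.pairwise_cons] at hl
    obtain ⟨l', h1, h2, h3⟩ := ih hl.2 (a ⊔ c)
    refine ⟨(a ⊓ c) :: l', ?_, ?_, ?_⟩
    · rw [List.pairwise_cons]
      exact ⟨h3 _ (inf_le_left.trans le_sup_left) fun d hd => inf_le_right.trans (hl.1 d hd), h1⟩
    · rw [List.map_cons, List.prod_cons, List.map_cons, List.prod_cons, ← h2, ← mul_assoc,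
        latticeVar_mul, mul_assoc, mul_left_comm]
    · intro x hxa hx d hd
      rw [List.mem_cons] at hd
      rcases hd with rfl | hd
      · exact le_inf hxa (hx c (by simp))
      · exact h3 x (hxa.trans le_sup_left) (fun e he => hx e (by simp [he])) d hd

/-- Straightening: every monomial of `H[L]` equals a monomial supported on a chain. -/
lemma exists_chain (l : List L) : ∃ l' : List L, l'.Pairwise (· ≤ ·) ∧
    (l.map (latticeVar K)).prod = (l'.map (latticeVar K)).prod := by
  induction l with
  | nil => exact ⟨[], by simp⟩
  | cons a l ih =>
    obtain ⟨l', h1, h2⟩ := ih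
    obtain ⟨l'', h3, h4, -⟩ := exists_chain_insert (K := K) l' h1 a
    exact ⟨l'', h3, by rw [List.map_cons, List.prod_cons, h2, h4]⟩

lemma span_chains_eq_top :
    Submodule.span K ((fun l : List L => (l.map (latticeVar K)).prod) ''
      {l | l.Pairwise (· ≤ ·)}) = ⊤ := by
  have hadj : Algebra.adjoin K (Set.range (latticeVar K : L → LatticeAlgebra K L)) = ⊤ := by
    have := congrArg (Subalgebra.map (Ideal.Quotient.mkₐ K (joinMeetIdeal K L)))
      (MvPolynomial.adjoin_range_X (R := K) (σ := L))
    rw [← Algebra.adjoin_image, ← Set.range_comp, Algebra.map_top,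
      (AlgHom.range_eq_top _).2 (Ideal.Quotient.mkₐ_surjective K _)] at this
    exact this
  rw [eq_top_iff, ← Algebra.top_toSubmodule, ← hadj, Algebra.adjoin_eq_span]
  refine Submodule.span_mono fun p hp => ?_
  obtain ⟨m, hm, rfl⟩ := Submonoid.exists_list_of_mem_closure hp
  have : ∃ l : List L, l.map (latticeVar K) = m := by
    rwa [← Set.mem_range, Set.range_list_map]
  obtain ⟨l, rfl⟩ := this
  obtain ⟨l', h1, h2⟩ := exists_chain (K := K) l
  exact ⟨l', h1, h2.symm⟩

/-- The subsets of `L` whose indicator function is a valuation, i.e. takes the same sum on a pair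
`a, b` as on the pair `a ⊔ b, a ⊓ b`. Among these are the prime filters and their complements,
which are the ones that separate elements in a distributive lattice. -/
abbrev ValuationSet (L : Type*) [Lattice L] : Type _ :=
  {P : Set L // ∀ a b, P.indicator (1 : L → ℕ) a + P.indicator 1 b =
    P.indicator 1 (a ⊔ b) + P.indicator 1 (a ⊓ b)}

variable [Finite L]

/-- The exponent vector of `a` in the toric presentation of `H[L]`, with one coordinate for each
valuation set. -/
noncomputable def toricExponent (a : L) : ValuationSet L →₀ ℕ :=
  Finsupp.equivFunOnFinite.symm fun P => P.1.indicator 1 a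

lemma toricExponent_apply (a : L) (P : ValuationSet L) :
    toricExponent a P = P.1.indicator 1 a := rfl

lemma toricExponent_add (a b : L) :
    toricExponent a + toricExponent b = toricExponent (a ⊔ b) + toricExponent (a ⊓ b) :=
  Finsupp.ext fun P => P.2 a b

/-- The toric representation of `H[L]`, which sends a monomial to a monomial. -/
noncomputable def toricHom (K L : Type*) [Field K] [Lattice L] [Finite L] :
    LatticeAlgebra K L →ₐ[K] MvPolynomial (ValuationSet L) K :=
  lift (fun a => MvPolynomial.monomial (toricExponent a) 1) fun a b _ => by
    rw [MvPolynomial.monomial_mul, MvPolynomial.monomial_mul, toricExponent_add]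

lemma toricHom_list_prod (l : List L) :
    toricHom K L (l.map (latticeVar K)).prod =
      MvPolynomial.monomial (l.map toricExponent).sum 1 := by
  induction l with
  | nil => simp
  | cons a l ih =>
    rw [List.map_cons, List.prod_cons, map_mul, ih, List.map_cons, List.sum_cons]
    simp [toricHom, MvPolynomial.monomial_mul]

/-- In a distributive lattice `a ≰ b` is witnessed by a prime filter that contains `a` but not `b`:
the one generated by a minimal element `p` with `p ≤ a` and `p ≰ b`. Its complement is returned. -/
lemma exists_valuationSet (hL : IsDistributiveLattice L) {a b : L} (hab : ¬ a ≤ b) :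
    ∃ P : ValuationSet L, (∀ c, a ≤ c → c ∉ P.1) ∧ b ∈ P.1 := by
  classical
  obtain ⟨p, hp⟩ := (Set.toFinite {p : L | p ≤ a ∧ ¬ p ≤ b}).exists_minimal ⟨a, le_rfl, hab⟩
  have hprime : ∀ u v, p ≤ u ⊔ v → p ≤ u ∨ p ≤ v := by
    intro u v huv
    by_contra! h
    have hlt : ∀ w, ¬ p ≤ w → p ⊓ w ≤ b := fun w hw => by
      by_contra hb
      exact hw ((hp.2 ⟨inf_le_left.trans hp.1.1, hb⟩ inf_le_left).trans inf_le_right)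
    apply hp.1.2
    rw [← inf_eq_left.2 huv, (hL p u v).1]
    exact sup_le (hlt u h.1) (hlt v h.2)
  refine ⟨⟨(Set.Ici p)ᶜ, fun u v => ?_⟩, fun c hc => ?_, hp.1.2⟩
  · have h1 : p ≤ u ⊔ v ↔ p ≤ u ∨ p ≤ v :=
      ⟨hprime u v, fun h => h.elim (·.trans le_sup_left) (·.trans le_sup_right)⟩
    simp only [Set.indicator_apply, Set.mem_compl_iff, Set.mem_Ici, h1, le_inf_iff, Pi.one_apply]
    by_cases hu : p ≤ u <;> by_cases hv : p ≤ v <;> simp [hu, hv]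
  · simpa using hp.1.1.trans hc

lemma sum_toricExponent_apply (l : List L) (P : ValuationSet L) :
    (l.map toricExponent).sum P = (l.map (P.1.indicator (1 : L → ℕ))).sum := by
  induction l with
  | nil => simp
  | cons a l ih =>
    rw [List.map_cons, List.sum_cons, Finsupp.add_apply, ih, List.map_cons, List.sum_cons,
      toricExponent_apply]

/-- If the toric monomial of `b` divides that of a list of elements above `a`, then `a ≤ b`: the
complement of a prime filter containing `a` but not `b` would contribute to `b` only. -/
lemma head_le_of_sum_toricExponent_le (hL : IsDistributiveLattice L) {a b : L} {l : List L}
    (hl : ∀ c ∈ l, a ≤ c) (h : toricExponent b ≤ (l.map toricExponent).sum) : a ≤ b := by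
  by_contra hab
  obtain ⟨P, h1, h2⟩ := exists_valuationSet hL hab
  have h3 := h P
  rw [sum_toricExponent_apply, toricExponent_apply, Set.indicator_of_mem h2, Pi.one_apply] at h3
  have : (l.map (P.1.indicator (1 : L → ℕ))).sum = 0 := by
    rw [List.sum_eq_zero_iff]
    simp only [List.mem_map]
    rintro _ ⟨c, hc, rfl⟩
    exact Set.indicator_of_notMem (h1 c (hl c hc)) _
  omega

/-- The toric exponent vector determines a chain: the least element is recovered first, and the
coordinate of the valuation set `univ` counts the elements, which settles the empty chain. -/
lemma sum_toricExponent_injOn (hL : IsDistributiveLattice L) :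
    Set.InjOn (fun l : List L => (l.map toricExponent).sum) {l | l.Pairwise (· ≤ ·)} := by
  intro l hl l' hl' h
  dsimp only at h
  induction l generalizing l' with
  | nil =>
    cases l' with
    | nil => rfl
    | cons b l' =>
      have := DFunLike.congr_fun h (⟨Set.univ, by simp⟩ : ValuationSet L)
      simp [toricExponent_apply] at this
      omega
  | cons a l ih =>
    cases l' with
    | nil =>
      have := DFunLike.congr_fun h (⟨Set.univ, by simp⟩ : ValuationSet L)
      simp [toricExponent_apply] at this
    | cons b l' =>
      simp only [Set.mem_ofPred_eq, List.pairwise_cons] at hl hl'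
      have h1 : a ≤ b := by
        refine head_le_of_sum_toricExponent_le hL (l := a :: l) (by simpa using hl.1) ?_
        rw [h, List.map_cons, List.sum_cons]
        exact le_self_add
      have h2 : b ≤ a := by
        refine head_le_of_sum_toricExponent_le hL (l := b :: l') (by simpa using hl'.1) ?_
        rw [← h, List.map_cons, List.sum_cons]
        exact le_self_add
      obtain rfl := le_antisymm h1 h2
      rw [List.map_cons, List.sum_cons, List.map_cons, List.sum_cons, add_right_inj] at h
      rw [ih hl.2 hl'.2 h]

/-- The colon ideals of the filtration: if `a` is minimal outside the lower set `T`, then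
`(T) : a` is generated by the variables `b` with `a ≰ b`. Modulo these, `H[L]` is spanned by the
monomials of chains above `a`, and multiplication by `a` keeps such monomials distinct and
outside `(T)`. -/
lemma mul_latticeVar_mem_varIdeal_iff (hL : IsDistributiveLattice L) {T : Set L}
    (hT : IsLowerSet T) {a : L} (haT : a ∉ T) (ha : ∀ b, b < a → b ∈ T)
    (g : LatticeAlgebra K L) :
    g * latticeVar K a ∈ varIdeal K T ↔ g ∈ varIdeal K {b | ¬ a ≤ b} := by
  have hback : ∀ g ∈ varIdeal K {b | ¬ a ≤ b}, g * latticeVar K a ∈ varIdeal K T := by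
    intro g hg
    refine Submodule.span_induction ?_ (by simp) (fun x y _ _ hx hy => by
      rw [add_mul]; exact add_mem hx hy) (fun c x _ hx => by
      rw [smul_eq_mul, mul_assoc]; exact Ideal.mul_mem_left _ _ hx) hg
    rintro _ ⟨b, hb, rfl⟩
    rw [latticeVar_mul]
    exact Ideal.mul_mem_left _ _ (latticeVar_mem_varIdeal (ha _ (inf_lt_right.2 hb)))
  refine ⟨fun hg => ?_, hback g⟩
  set mon : List L → LatticeAlgebra K L := fun l => (l.map (latticeVar K)).prod with hmon
  set C : Set (List L) := {l | l.Pairwise (· ≤ ·) ∧ ∀ c ∈ l, a ≤ c} with hC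
  have htop : (varIdeal K {b | ¬ a ≤ b}).restrictScalars K ⊔ Submodule.span K (mon '' C) = ⊤ := by
    rw [eq_top_iff, ← span_chains_eq_top, Submodule.span_le]
    rintro _ ⟨l, hl, rfl⟩
    by_cases h : ∀ c ∈ l, a ≤ c
    · exact Submodule.mem_sup_right (Submodule.subset_span ⟨l, ⟨hl, h⟩, rfl⟩)
    · push Not at h
      obtain ⟨c, hc, hac⟩ := h
      refine Submodule.mem_sup_left ?_
      exact Ideal.mem_of_dvd _ (List.dvd_prod (List.mem_map_of_mem hc))
        (latticeVar_mem_varIdeal hac)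
  obtain ⟨n, hn, s, hs, rfl⟩ := Submodule.mem_sup.1 (htop ▸ Submodule.mem_top : g ∈ _)
  obtain ⟨q, hq, rfl⟩ := (Finsupp.mem_span_image_iff_linearCombination K).1 hs
  rw [add_mul] at hg
  have hs' := (Ideal.add_mem_iff_right _ (hback n hn)).1 hg
  have hmap := Ideal.mem_map_of_mem (toricHom K L) hs'
  rw [varIdeal, Ideal.map_span, ← Set.image_comp] at hmap
  have himg : (toricHom K L) ∘ latticeVar K '' T =
      (fun u => MvPolynomial.monomial u (1 : K)) '' (toricExponent '' T) := by
    rw [← Set.image_comp]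
    exact Set.image_congr fun b _ => by simp [toricHom]
  rw [himg, MvPolynomial.mem_ideal_span_monomial_image] at hmap
  suffices q = 0 by
    subst this
    simpa using hn
  by_contra hq0
  obtain ⟨l, hl⟩ := Finsupp.support_nonempty_iff.2 hq0
  have hchain : ∀ l ∈ q.support, (a :: l).Pairwise (· ≤ ·) := fun l hl => by
    rw [List.pairwise_cons]
    exact ⟨(hq hl).2, (hq hl).1⟩
  have hcoeff : MvPolynomial.coeff ((a :: l).map toricExponent).sum
      (toricHom K L (Finsupp.linearCombination K mon q * latticeVar K a)) = q l := by
    have : toricHom K L (Finsupp.linearCombination K mon q * latticeVar K a) =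
        ∑ l ∈ q.support, MvPolynomial.monomial ((a :: l).map toricExponent).sum (q l) := by
      rw [Finsupp.linearCombination_apply, Finsupp.sum, Finset.sum_mul, map_sum]
      refine Finset.sum_congr rfl fun l _ => ?_
      have : q l • mon l * latticeVar K a = q l • ((a :: l).map (latticeVar K)).prod := by
        rw [smul_mul_assoc, List.map_cons, List.prod_cons, mul_comm]
      rw [this, map_smul, toricHom_list_prod, MvPolynomial.smul_monomial, smul_eq_mul, mul_one]
    rw [this, MvPolynomial.coeff_sum, Finset.sum_eq_single l]
    · simp
    · intro l' hl' hne
      rw [MvPolynomial.coeff_monomial, if_neg]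
      intro h
      have := sum_toricExponent_injOn hL (hchain l' hl') (hchain l hl) h
      exact hne (List.cons.inj this).2
    · exact fun h => absurd hl h
  obtain ⟨_, ⟨b, hb, rfl⟩, hle⟩ := hmap _ (MvPolynomial.mem_support_iff.2
    (hcoeff ▸ Finsupp.mem_support_iff.1 hl))
  refine haT (hT (head_le_of_sum_toricExponent_le hL (l := a :: l) ?_ hle) hb)
  simpa using (hq hl).2

lemma exists_filtration_of_distributive (hL : IsDistributiveLattice L) :
    ∃ F : Set (Ideal (LatticeAlgebra K L)), IsCombinatorialKoszulFiltration K F := by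
  refine ⟨_, isCombinatorialKoszulFiltration_of_sets {S | IsLowerSet S} isLowerSet_empty
    isLowerSet_univ fun S hS hne => ?_⟩
  obtain ⟨a, haS, ha⟩ := (Set.toFinite S).exists_maximal hne
  refine ⟨a, S \ {a}, ?_, {b | ¬ a ≤ b}, ?_, by simp, by simp [Set.insert_eq_of_mem haS], ?_⟩
  · rintro b c hcb ⟨hb, hba⟩
    refine ⟨hS hcb hb, ?_⟩
    rintro rfl
    exact hba (le_antisymm (ha hb hcb) hcb)
  · exact fun b c hcb hb hac => hb (hac.trans hcb)
  · refine mul_latticeVar_mem_varIdeal_iff hL ?_ (by simp) fun b hb => ⟨hS hb.le haS, hb.ne⟩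
    rintro b c hcb ⟨hb, hba⟩
    refine ⟨hS hcb hb, ?_⟩
    rintro rfl
    exact hba (le_antisymm (ha hb hcb) hcb)

end Distributive

end LatticeAlgebra

/-! ### Diamonds in modular lattices -/

/-- The elements `x, y, z` generate a diamond with bottom `e` and top `f`: any two of them meet in
`e` and join to `f`. The degenerate case `e = f` is not excluded. -/
structure IsDiamond {L : Type*} [Lattice L] (e x y z f : L) : Prop where
  inf_xy : x ⊓ y = e
  inf_yz : y ⊓ z = e
  inf_xz : x ⊓ z = e
  sup_xy : x ⊔ y = f
  sup_yz : y ⊔ z = f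
  sup_xz : x ⊔ z = f

section Modular

variable {L : Type*} [Lattice L]

lemma isDistributiveLattice_of_inf_sup (h : ∀ a b c : L, a ⊓ (b ⊔ c) ≤ (a ⊓ b) ⊔ (a ⊓ c)) :
    IsDistributiveLattice L := by
  let _ : DistribLattice L := DistribLattice.ofInfSupLe h
  exact fun x y z => ⟨inf_sup_left x y z, sup_inf_left x y z⟩

variable [IsModularLattice L]

/-- The elements `(a ⊓ f) ⊔ e` and `(b ⊓ f) ⊔ e` meet in `e`, where `e` and `f` are the lower and the
upper median of `a, b, c`. -/
lemma median_inf (a b c : L) :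
    ((a ⊓ ((a ⊔ b) ⊓ (b ⊔ c) ⊓ (c ⊔ a))) ⊔ ((a ⊓ b) ⊔ (b ⊓ c) ⊔ (c ⊓ a))) ⊓
      ((b ⊓ ((a ⊔ b) ⊓ (b ⊔ c) ⊓ (c ⊔ a))) ⊔ ((a ⊓ b) ⊔ (b ⊓ c) ⊔ (c ⊓ a))) =
    (a ⊓ b) ⊔ (b ⊓ c) ⊔ (c ⊓ a) := by
  set f := (a ⊔ b) ⊓ (b ⊔ c) ⊓ (c ⊔ a) with hf
  set e := (a ⊓ b) ⊔ (b ⊓ c) ⊔ (c ⊓ a) with he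
  have h1 : b ⊓ f ⊔ e ≤ b ⊔ (c ⊓ a) := by
    refine sup_le (inf_le_left.trans le_sup_left) (sup_le (sup_le ?_ ?_) le_sup_right)
    · exact inf_le_right.trans le_sup_left
    · exact inf_le_left.trans le_sup_left
  refine le_antisymm ?_ (le_inf le_sup_right le_sup_right)
  rw [sup_comm, sup_inf_assoc_of_le _ le_sup_right]
  refine sup_le le_rfl ?_
  calc a ⊓ f ⊓ (b ⊓ f ⊔ e) ≤ a ⊓ ((c ⊓ a) ⊔ b) := by
        rw [sup_comm (c ⊓ a) b]
        exact inf_le_inf inf_le_left h1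
    _ = (c ⊓ a) ⊔ (b ⊓ a) := by rw [inf_comm, sup_inf_assoc_of_le _ inf_le_right]
    _ ≤ e := sup_le le_sup_right ((inf_comm b a).le.trans (le_sup_left.trans le_sup_left))

lemma median_sup (a b c : L) :
    ((a ⊓ ((a ⊔ b) ⊓ (b ⊔ c) ⊓ (c ⊔ a))) ⊔ ((a ⊓ b) ⊔ (b ⊓ c) ⊔ (c ⊓ a))) ⊔
      ((b ⊓ ((a ⊔ b) ⊓ (b ⊔ c) ⊓ (c ⊔ a))) ⊔ ((a ⊓ b) ⊔ (b ⊓ c) ⊔ (c ⊓ a))) =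
    (a ⊔ b) ⊓ (b ⊔ c) ⊓ (c ⊔ a) := by
  have hef : (a ⊓ b) ⊔ (b ⊓ c) ⊔ (c ⊓ a) ≤ (a ⊔ b) ⊓ (b ⊔ c) ⊓ (c ⊔ a) := by
    refine sup_le (sup_le ?_ ?_) ?_ <;> refine le_inf (le_inf ?_ ?_) ?_
    · exact inf_le_left.trans le_sup_left
    · exact inf_le_right.trans le_sup_left
    · exact inf_le_left.trans le_sup_right
    · exact inf_le_left.trans le_sup_right
    · exact inf_le_left.trans le_sup_left
    · exact inf_le_right.trans le_sup_left
    · exact inf_le_right.trans le_sup_left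
    · exact inf_le_left.trans le_sup_right
    · exact inf_le_left.trans le_sup_left
  have := median_inf (L := Lᵒᵈ) (OrderDual.toDual a) (OrderDual.toDual b) (OrderDual.toDual c)
  have := congrArg OrderDual.ofDual this
  simp only [ofDual_inf, ofDual_sup, OrderDual.ofDual_toDual] at this
  have hmod : ∀ u, (u ⊔ ((a ⊓ b) ⊔ (b ⊓ c) ⊔ (c ⊓ a))) ⊓ ((a ⊔ b) ⊓ (b ⊔ c) ⊓ (c ⊔ a)) =
      (u ⊓ ((a ⊔ b) ⊓ (b ⊔ c) ⊓ (c ⊔ a))) ⊔ ((a ⊓ b) ⊔ (b ⊓ c) ⊔ (c ⊓ a)) := fun u => by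
    rw [sup_comm, sup_inf_assoc_of_le u hef, sup_comm]
  rwa [hmod, hmod] at this

/-- The medians of `a, b, c` span a diamond, and if they agree, then the distributive law holds for
`a, b, c`. -/
lemma exists_isDiamond (hL : ¬ IsDistributiveLattice L) :
    ∃ e x y z f : L, e ≠ f ∧ IsDiamond e x y z f := by
  by_contra! h
  refine hL (isDistributiveLattice_of_inf_sup fun a b c => ?_)
  set f := (a ⊔ b) ⊓ (b ⊔ c) ⊓ (c ⊔ a) with hf
  set e := (a ⊓ b) ⊔ (b ⊓ c) ⊔ (c ⊓ a) with he
  have hfc : (b ⊔ c) ⊓ (c ⊔ a) ⊓ (a ⊔ b) = f := by rw [inf_comm, ← inf_assoc]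
  have hec : (b ⊓ c) ⊔ (c ⊓ a) ⊔ (a ⊓ b) = e := by rw [sup_comm, ← sup_assoc]
  have hfc' : (c ⊔ a) ⊓ (a ⊔ b) ⊓ (b ⊔ c) = f := by rw [inf_assoc, inf_comm]
  have hec' : (c ⊓ a) ⊔ (a ⊓ b) ⊔ (b ⊓ c) = e := by rw [sup_assoc, sup_comm]
  have i1 := median_inf a b c
  have i2 := median_inf b c a
  have i3 := median_inf c a b
  have s1 := median_sup a b c
  have s2 := median_sup b c a
  have s3 := median_sup c a b
  rw [hfc, hec] at i2 s2
  rw [hfc', hec', inf_comm] at i3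
  rw [hfc', hec', sup_comm] at s3
  have hef : e = f := by
    by_contra hne
    exact h _ _ _ _ _ hne ⟨i1, i2, i3, s1, s2, s3⟩
  calc a ⊓ (b ⊔ c) ≤ a ⊓ f := le_inf inf_le_left
        (le_inf (le_inf (inf_le_left.trans le_sup_left) inf_le_right)
          (inf_le_left.trans le_sup_right))
    _ = ((a ⊓ b) ⊔ (c ⊓ a) ⊔ (b ⊓ c)) ⊓ a := by
        rw [← hef, he, inf_comm, sup_right_comm]
    _ = (a ⊓ b) ⊔ (c ⊓ a) ⊔ (b ⊓ c) ⊓ a :=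
        sup_inf_assoc_of_le _ (sup_le inf_le_left inf_le_right)
    _ ≤ (a ⊓ b) ⊔ (a ⊓ c) := by
        refine sup_le (sup_le le_sup_left ?_) ?_
        · exact (inf_comm c a).le.trans le_sup_right
        · exact le_sup_of_le_left (le_inf inf_le_right (inf_le_left.trans inf_le_left))

/-- A diamond in a finite modular lattice can be shrunk until its middle elements are atoms: starting
from an atom `x'` of `[e, x]`, replace `y` and `z` by `y ⊓ (x' ⊔ z)` and `z ⊓ (x' ⊔ y)`. -/
lemma exists_covBy_isDiamond [Finite L] (hL : ¬ IsDistributiveLattice L) :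
    ∃ e x y z f : L, IsDiamond e x y z f ∧ (∀ c, c = x ∨ c = y ∨ c = z → e ⋖ c ∧ c ⋖ f) := by
  obtain ⟨e, x, y, z, f, hef, h⟩ := exists_isDiamond hL
  have hex : e < x := by
    refine lt_of_le_of_ne (h.inf_xy ▸ inf_le_left) ?_
    rintro rfl
    have hy : y = f := by rw [← h.sup_xy, sup_eq_right.2 (inf_eq_left.1 h.inf_xy)]
    have hz : z = f := by rw [← h.sup_xz, sup_eq_right.2 (inf_eq_left.1 h.inf_xz)]
    exact hef (by rw [← h.inf_yz, hy, hz, inf_idem])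
  obtain ⟨w, hw, hwx⟩ := exists_covBy_le_of_lt hex
  set y' := y ⊓ (w ⊔ z) with hy'
  set z' := z ⊓ (w ⊔ y) with hz'
  have hey' : e ≤ y' := le_inf (h.inf_xy ▸ inf_le_right) (hw.le.trans le_sup_left)
  have hez' : e ≤ z' := le_inf (h.inf_xz ▸ inf_le_right) (hw.le.trans le_sup_left)
  have hwy : w ⊔ y' = (w ⊔ y) ⊓ (w ⊔ z) := (sup_inf_assoc_of_le y le_sup_left).symm
  have hwz : w ⊔ z' = (w ⊔ y) ⊓ (w ⊔ z) := by
    rw [inf_comm]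
    exact (sup_inf_assoc_of_le z le_sup_left).symm
  have hyz : y' ⊔ z' = (w ⊔ y) ⊓ (w ⊔ z) := by
    have h1 : z' ⊔ y = w ⊔ y := by
      rw [hz', sup_comm, ← sup_inf_assoc_of_le z le_sup_right, h.sup_yz, inf_eq_right]
      exact sup_le (hwx.trans (h.sup_xy ▸ le_sup_left)) (h.sup_xy ▸ le_sup_right)
    rw [hy', sup_comm, ← sup_inf_assoc_of_le y (inf_le_left.trans le_sup_right), h1]
  have hd : IsDiamond e w y' z' ((w ⊔ y) ⊓ (w ⊔ z)) := by
    refine ⟨?_, ?_, ?_, hwy, hyz, hwz⟩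
    · exact le_antisymm (h.inf_xy ▸ inf_le_inf hwx inf_le_left) (le_inf hw.le hey')
    · exact le_antisymm (h.inf_yz ▸ inf_le_inf inf_le_left inf_le_left) (le_inf hey' hez')
    · exact le_antisymm (h.inf_xz ▸ inf_le_inf hwx inf_le_left) (le_inf hw.le hez')
  have hyf : y' ⋖ (w ⊔ y) ⊓ (w ⊔ z) := by
    rw [← hd.sup_xy]; exact covBy_sup_of_inf_covBy_left (hd.inf_xy ▸ hw)
  have hzf : z' ⋖ (w ⊔ y) ⊓ (w ⊔ z) := by
    rw [← hd.sup_xz]; exact covBy_sup_of_inf_covBy_left (hd.inf_xz ▸ hw)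
  have hey : e ⋖ y' := by
    rw [← hd.inf_yz]; exact inf_covBy_of_covBy_sup_right (hd.sup_yz ▸ hzf)
  have hez : e ⋖ z' := by
    rw [← hd.inf_yz]; exact inf_covBy_of_covBy_sup_left (hd.sup_yz ▸ hyf)
  have hwf : w ⋖ (w ⊔ y) ⊓ (w ⊔ z) := by
    rw [← hd.sup_xy]; exact covBy_sup_of_inf_covBy_right (hd.inf_xy ▸ hey)
  refine ⟨e, w, y', z', _, hd, ?_⟩
  rintro c (rfl | rfl | rfl)
  exacts [⟨hw, hwf⟩, ⟨hey, hyf⟩, ⟨hez, hzf⟩]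

end Modular

/-! ### A covering diamond excludes a combinatorial Koszul filtration -/

namespace LatticeAlgebra

section Diamond

variable {K L : Type*} [Field K] [Lattice L]

lemma intervalHom_eq_zero_of_mem {e f : L} {S : Set L} (hS : ∀ s ∈ S, s ∉ Set.Icc e f)
    {p : LatticeAlgebra K L} (hp : p ∈ varIdeal K S) : intervalHom K e f p = 0 :=
  map_eq_zero_of_mem_varIdeal _ (fun s hs => by
    rw [intervalHom_latticeVar, if_neg (hS s hs)]) hp

lemma fst_dualHom_eq_zero_of_mem (a : L) {S : Set L} {p : LatticeAlgebra K L}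
    (hp : p ∈ varIdeal K S) : (dualHom K a p).fst = 0 :=
  map_eq_zero_of_mem_varIdeal ((TrivSqZeroExt.fstHom K K K).comp (dualHom K a)) (fun s _ => by
    rw [AlgHom.comp_apply, dualHom_latticeVar]
    split_ifs <;> simp) hp

/-- If `I / J` is cyclic for ideals generated by variables, then at most one variable of `I` is
missing from `J`: in degree one, `I / J` has dimension at most one. -/
lemma eq_of_isPrincipal {A B : Set L}
    (h : (Submodule.map (Submodule.mkQ (varIdeal K B)) (varIdeal K A)).IsPrincipal)
    {u w : L} (huA : u ∈ A) (hwA : w ∈ A) (huB : u ∉ B) (hwB : w ∉ B) : w = u := by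
  by_contra hwu
  obtain ⟨γ, hγ⟩ := h.principal
  have hγmem : γ ∈ Submodule.map (Submodule.mkQ (varIdeal K B)) (varIdeal K A) :=
    hγ ▸ Submodule.mem_span_singleton_self γ
  obtain ⟨g, hg, rfl⟩ := hγmem
  have key : ∀ a ∈ A, ∃ r : LatticeAlgebra K L, r * g - latticeVar K a ∈ varIdeal K B := by
    intro a ha
    have := Submodule.mem_map_of_mem (f := Submodule.mkQ (varIdeal K B))
      (latticeVar_mem_varIdeal (K := K) ha)
    rw [hγ, Submodule.mem_span_singleton] at this
    obtain ⟨r, hr⟩ := this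
    refine ⟨r, ?_⟩
    rw [← map_smul] at hr
    exact (Submodule.Quotient.eq _).1 hr
  obtain ⟨r, hr⟩ := key u huA
  obtain ⟨s, hs⟩ := key w hwA
  have hB : ∀ c ∉ B, ∀ p ∈ varIdeal K B, (dualHom K c p).snd = 0 := fun c hc p hp => by
    rw [map_eq_zero_of_mem_varIdeal (dualHom K c) (fun b hb => by
      rw [dualHom_latticeVar, if_neg (fun h : b = c => hc (h ▸ hb))]) hp, TrivSqZeroExt.snd_zero]
  have e1 := hB u huB _ hr
  have e2 := hB w hwB _ hr
  have e3 := hB w hwB _ hs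
  simp only [map_sub, map_mul, dualHom_latticeVar, TrivSqZeroExt.snd_sub, TrivSqZeroExt.snd_mul,
    fst_dualHom_eq_zero_of_mem _ hg, if_neg (Ne.symm hwu), if_true, DualNumber.snd_eps,
    TrivSqZeroExt.snd_zero] at e1 e2 e3
  have hfst : (dualHom K u r).fst = (dualHom K w r).fst := by
    have : (TrivSqZeroExt.fstHom K K K).comp (dualHom K u) =
        (TrivSqZeroExt.fstHom K K K).comp (dualHom K w) := by
      refine Ideal.Quotient.algHom_ext _ (MvPolynomial.algHom_ext fun b => ?_)
      change (dualHom K u (latticeVar K b)).fst = (dualHom K w (latticeVar K b)).fst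
      rw [dualHom_latticeVar, dualHom_latticeVar]
      split_ifs <;> simp
    exact DFunLike.congr_fun this r
  rw [hfst] at e1
  simp at e1 e2 e3
  grind

/-- Every variable `u` of a covering diamond is a zero divisor in such a way that a set `S` of
variables whose ideal contains the annihilator of `u` has to meet `[e, f]`. The annihilators used are
`f (x - y)` for `u = e`, `e (x - y)` for `u = f`, and otherwise the difference of two of `x, y, z`
that are complementary to `u`. -/
lemma exists_mem_Icc_of_annihilator {e x y z f : L} (hd : IsDiamond e x y z f)
    (hc : ∀ c, c = x ∨ c = y ∨ c = z → e ⋖ c ∧ c ⋖ f) {u : L} (hu : u ∈ Set.Icc e f) {S : Set L}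
    (hS : ∀ p : LatticeAlgebra K L, p * latticeVar K u = 0 → p ∈ varIdeal K S) :
    ∃ s ∈ S, s ∈ Set.Icc e f := by
  have hx := hc x (by simp)
  have hy := hc y (by simp)
  have hz := hc z (by simp)
  have hxy : x ≠ y := by
    rintro rfl
    exact hx.1.ne (hd.inf_xy.symm.trans (inf_idem x))
  have hyz : y ≠ z := by
    rintro rfl
    exact hy.1.ne (hd.inf_yz.symm.trans (inf_idem y))
  have hxz : x ≠ z := by
    rintro rfl
    exact hx.1.ne (hd.inf_xz.symm.trans (inf_idem x))
  have mxy : latticeVar K x * latticeVar K y = latticeVar K f * latticeVar K e := by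
    rw [latticeVar_mul, hd.sup_xy, hd.inf_xy]
  have myz : latticeVar K y * latticeVar K z = latticeVar K f * latticeVar K e := by
    rw [latticeVar_mul, hd.sup_yz, hd.inf_yz]
  have mxz : latticeVar K x * latticeVar K z = latticeVar K f * latticeVar K e := by
    rw [latticeVar_mul, hd.sup_xz, hd.inf_xz]
  -- Both `y z` and `x z` equal `e f`, hence `e f x = x y z = e f y`.
  have hefxy : latticeVar K f * latticeVar K e * (latticeVar K x - latticeVar K y) = 0 := by
    linear_combination (latticeVar K x) * (-myz) + (latticeVar K y) * mxz
  by_contra! hdisj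
  have hyx : ¬ y ≤ x := fun h => hy.1.ne (by rw [← hd.inf_xy, inf_eq_right.2 h])
  have hxy' : ¬ x ≤ y := fun h => hx.1.ne (by rw [← hd.inf_xy, inf_eq_left.2 h])
  have hef := hx.1.le.trans hx.2.le
  by_cases hue : u = e
  · have hp := hS (latticeVar K f * (latticeVar K x - latticeVar K y)) (by
      rw [hue]; linear_combination hefxy)
    have := intervalHom_eq_zero_of_mem (e := x) (f := f)
      (fun s hs hsx => hdisj s hs ⟨hx.1.le.trans hsx.1, hsx.2⟩) hp
    simp [hx.2.le, hxy'] at this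
  by_cases huf : u = f
  · have hp := hS (latticeVar K e * (latticeVar K x - latticeVar K y)) (by
      rw [huf]; linear_combination hefxy)
    have := intervalHom_eq_zero_of_mem (e := e) (f := x)
      (fun s hs hsx => hdisj s hs ⟨hsx.1, hsx.2.trans hx.2.le⟩) hp
    simp [hx.1.le, hyx] at this
  -- Otherwise `u` lies strictly between `e` and `f`, and the middle elements other than `u` are
  -- complementary to it.
  have hcomp : ∀ c, c = x ∨ c = y ∨ c = z → c ≠ u →
      latticeVar K c * latticeVar K u = latticeVar K f * latticeVar K e := by
    intro c hcc hcu
    obtain ⟨h1, h2⟩ := hc c hcc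
    have hinf : c ⊓ u = e := by
      refine (h1.eq_or_eq (le_inf h1.le hu.1) inf_le_left).resolve_right fun h => ?_
      rcases h2.eq_or_eq (inf_eq_left.1 h) hu.2 with h | h
      exacts [hcu h.symm, huf h]
    have hsup : c ⊔ u = f := by
      refine (h2.eq_or_eq le_sup_left (sup_le h2.le hu.2)).resolve_left fun h => ?_
      rcases h1.eq_or_eq hu.1 (sup_eq_left.1 h) with h | h
      exacts [hue h, hcu h.symm]
    rw [latticeVar_mul, hinf, hsup]
  have hfin : ∀ c d, (c = x ∨ c = y ∨ c = z) → (d = x ∨ d = y ∨ d = z) → c ≠ d → c ≠ u →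
      d ≠ u → False := by
    intro c d hcc hdd hcd hcu hdu
    have hp := hS (latticeVar K c - latticeVar K d) (by
      rw [sub_mul, hcomp c hcc hcu, hcomp d hdd hdu, sub_self])
    have hcS : c ∉ S := fun h => hdisj c h ⟨(hc c hcc).1.le, (hc c hcc).2.le⟩
    have := map_eq_zero_of_mem_varIdeal (dualHom K c) (fun s hs => by
      rw [dualHom_latticeVar, if_neg (fun h : s = c => hcS (h ▸ hs))]) hp
    have := congrArg TrivSqZeroExt.snd this
    simp [Ne.symm hcd] at this
  by_cases hux : x = u
  · exact hfin y z (by simp) (by simp) hyz (hux ▸ hxy.symm) (hux ▸ hxz.symm)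
  by_cases huy : y = u
  · exact hfin x z (by simp) (by simp) hxz hux (huy ▸ hyz.symm)
  · exact hfin x y (by simp) (by simp) hxy hux huy

lemma isDistributiveLattice_of_filtration [Finite L] [IsModularLattice L]
    {F : Set (Ideal (LatticeAlgebra K L))} (hF : IsCombinatorialKoszulFiltration K F) :
    IsDistributiveLattice L := by
  by_contra hL
  obtain ⟨e, x, y, z, f, hd, hc⟩ := exists_covBy_isDiamond hL
  have hef : e ≤ f := (hc x (by simp)).1.le.trans (hc x (by simp)).2.le
  have hfin : F.Finite := by
    refine (Set.finite_range (varIdeal K : Set L → _)).subset fun I hI => ?_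
    obtain ⟨S, rfl⟩ := hF.2 I hI
    exact ⟨S, rfl⟩
  -- An ideal of `F` that is minimal among those containing a variable of `[e, f]`.
  obtain ⟨I, ⟨hI, u, hu, huI⟩, hmin⟩ :=
    (hfin.subset (Set.sep_subset F
      fun I => ∃ u ∈ Set.Icc e f, latticeVar K u ∈ I)).exists_minimal
    ⟨_, hF.1.maximal_mem, e, ⟨le_rfl, hef⟩, by
      rw [span_positive_degree_eq]; exact latticeVar_mem_varIdeal trivial⟩
  have hI0 : I ≠ ⊥ := by
    rintro rfl
    rw [← varIdeal_empty, latticeVar_mem_varIdeal_iff] at huI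
    exact huI
  obtain ⟨J, hJ, hJI, hcyc, hcol⟩ := hF.1.exists_colon I hI hI0
  obtain ⟨A, rfl : I = varIdeal K A⟩ := hF.2 I hI
  obtain ⟨B, rfl : J = varIdeal K B⟩ := hF.2 J hJ
  obtain ⟨S, hS : _ = varIdeal K S⟩ := hF.2 _ hcol
  have hB : ∀ b ∈ B, b ∉ Set.Icc e f := fun b hb hbT =>
    hJI.not_ge (hmin ⟨hJ, b, hbT, latticeVar_mem_varIdeal hb⟩ hJI.le)
  rw [latticeVar_mem_varIdeal_iff] at huI
  have hcolon : ∀ p : LatticeAlgebra K L, p * latticeVar K u = 0 → p ∈ varIdeal K S := by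
    intro p hp
    have hle : varIdeal K A ≤ varIdeal K (insert u B) := by
      refine Ideal.span_mono (Set.image_mono fun w hw => ?_)
      by_cases hwB : w ∈ B
      · exact Or.inr hwB
      · exact Or.inl (eq_of_isPrincipal hcyc huI hw (fun h => hB u h hu) hwB)
    have := mem_colon_varIdeal_insert.2 (hp ▸ (varIdeal K B).zero_mem :
      p * latticeVar K u ∈ varIdeal K B)
    rw [Submodule.mem_colon] at this
    rw [← hS, Submodule.mem_colon]
    exact fun q hq => this q (hle hq)
  obtain ⟨s, hs, hsT⟩ := exists_mem_Icc_of_annihilator hd hc hu hcolon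
  have hsu : latticeVar K s * latticeVar K u ∈ varIdeal K B := by
    have := hS.symm ▸ latticeVar_mem_varIdeal (K := K) hs
    exact Submodule.mem_colon.1 this _ (latticeVar_mem_varIdeal huI)
  have := intervalHom_eq_zero_of_mem hB hsu
  rw [map_mul, intervalHom_latticeVar, intervalHom_latticeVar, if_pos hsT, if_pos hu] at this
  simp at this

end Diamond

end LatticeAlgebra

/-! ### Linear maps acting on exponents -/

/-- The linear endomorphism of a polynomial ring that applies `φ` to the exponent of each
monomial. -/
noncomputable def mapExponents (K : Type*) {σ : Type*} [Field K] (φ : (σ →₀ ℕ) → (σ →₀ ℕ)) :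
    MvPolynomial σ K →ₗ[K] MvPolynomial σ K :=
  (MvPolynomial.basisMonomials σ K).constr K fun m => MvPolynomial.monomial (φ m) (1 : K)

section MapExponents

open MvPolynomial

variable {K σ : Type*} [Field K]

lemma mapExponents_monomial (φ : (σ →₀ ℕ) → (σ →₀ ℕ)) (m : σ →₀ ℕ) (c : K) :
    mapExponents K φ (monomial m c) = monomial (φ m) c := by
  have h : mapExponents K φ (monomial m 1) = monomial (φ m) 1 := by
    have := (basisMonomials σ K).constr_basis K (fun m => monomial (φ m) (1 : K)) m
    rwa [coe_basisMonomials] at this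
  rw [← mul_one c, ← smul_eq_mul, ← smul_monomial, map_smul, h, smul_monomial]

lemma mapExponents_mapExponents (φ ψ : (σ →₀ ℕ) → (σ →₀ ℕ)) (p : MvPolynomial σ K) :
    mapExponents K φ (mapExponents K ψ p) = mapExponents K (φ ∘ ψ) p := by
  induction p using MvPolynomial.induction_on' with
  | monomial m c => simp [mapExponents_monomial]
  | add p q hp hq => rw [map_add, map_add, hp, hq, map_add]

lemma mapExponents_add (s : σ →₀ ℕ) (p : MvPolynomial σ K) :
    mapExponents K (· + s) p = p * monomial s 1 := by
  induction p using MvPolynomial.induction_on' with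
  | monomial m c => simp [mapExponents_monomial, monomial_mul]
  | add p q hp hq => rw [map_add, hp, hq, add_mul]

lemma single_add_single_le_iff {i j : σ} (hij : i ≠ j) {m : σ →₀ ℕ} :
    Finsupp.single i 1 + Finsupp.single j 1 ≤ m ↔ 1 ≤ m i ∧ 1 ≤ m j := by
  classical
  refine ⟨fun h => ?_, fun h k => ?_⟩
  · have hi := h i
    have hj := h j
    simp [hij, hij.symm] at hi hj
    exact ⟨hi, hj⟩
  · simp only [Finsupp.add_apply, Finsupp.single_apply]
    split_ifs with h1 h2 h2
    · exact absurd (h1.trans h2.symm) hij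
    · exact h1 ▸ h.1
    · exact h2 ▸ h.2
    · exact Nat.zero_le _

end MapExponents

/-! ### The pentagon -/

namespace Pentagon

open MvPolynomial

instance : Finite Pentagon :=
  Finite.of_injective
    (fun a => match a with | e => (0 : Fin 5) | x => 1 | y => 2 | z => 3 | f => 4)
    fun a b h => by cases a <;> cases b <;> first | rfl | simp at h

instance : DecidableEq Pentagon := fun a b => by
  cases a <;> cases b <;> first | exact isTrue rfl | exact isFalse (by rintro ⟨⟩)

lemma not_isDistributiveLattice : ¬ IsDistributiveLattice Pentagon := fun h => by
  have : x = y := (h x y z).1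
  cases this

variable {K : Type*} [Field K]

lemma joinMeetIdeal_eq : joinMeetIdeal K Pentagon =
    Ideal.span {X x * X z - X f * X e, X y * X z - X f * X e} := by
  refine le_antisymm (Ideal.span_le.2 ?_) (Ideal.span_mono ?_)
  · have h1 : (X x * X z - X f * X e : MvPolynomial Pentagon K) ∈
        Ideal.span {X x * X z - X f * X e, X y * X z - X f * X e} := Ideal.subset_span (by simp)
    have h2 : (X y * X z - X f * X e : MvPolynomial Pentagon K) ∈
        Ideal.span {X x * X z - X f * X e, X y * X z - X f * X e} := Ideal.subset_span (by simp)
    rintro _ ⟨a, b, ⟨hab, hba⟩, rfl⟩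
    cases a <;> cases b <;> first
      | exact absurd trivial hab
      | exact absurd trivial hba
      | exact h1
      | exact h2
      | (rw [mul_comm (X z)]; first | exact h1 | exact h2)
  · rintro _ (rfl | rfl)
    · exact ⟨x, z, ⟨fun h => h, fun h => h⟩, rfl⟩
    · exact ⟨y, z, ⟨fun h => h, fun h => h⟩, rfl⟩

/-- The normal form of an exponent vector with respect to the rewriting rules `x z → e f`,
`y z → e f` and `e f y → e f x`. The first two apply `k = min (m z) (m x + m y)` times in total. -/
noncomputable def normalForm (m : Pentagon →₀ ℕ) : Pentagon →₀ ℕ :=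
  let k := min (m z) (m x + m y)
  Finsupp.equivFunOnFinite.symm fun a => match a with
    | e => m e + k
    | x => if m e + k = 0 ∨ m f + k = 0 then m x else m x + m y - k
    | y => if m e + k = 0 ∨ m f + k = 0 then m y else 0
    | z => m z - k
    | f => m f + k

/-- A left inverse, on normal forms, of multiplication by `x` followed by `normalForm`. -/
noncomputable def divX (m : Pentagon →₀ ℕ) : Pentagon →₀ ℕ :=
  Finsupp.equivFunOnFinite.symm fun a => match a with
    | e => if m x = 0 then m e - 1 else m e
    | x => m x - 1
    | y => m y
    | z => if m x = 0 then m z + 1 else m z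
    | f => if m x = 0 then m f - 1 else m f

lemma normalForm_xz (m : Pentagon →₀ ℕ) :
    normalForm (m + (Finsupp.single x 1 + Finsupp.single z 1)) =
      normalForm (m + (Finsupp.single f 1 + Finsupp.single e 1)) := by
  ext a
  cases a <;> simp [normalForm] <;> grind

lemma normalForm_yz (m : Pentagon →₀ ℕ) :
    normalForm (m + (Finsupp.single y 1 + Finsupp.single z 1)) =
      normalForm (m + (Finsupp.single f 1 + Finsupp.single e 1)) := by
  ext a
  cases a <;> simp [normalForm] <;> grind

lemma normalForm_efy (m : Pentagon →₀ ℕ) :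
    normalForm (m + (Finsupp.single e 1 + Finsupp.single f 1 + Finsupp.single y 1)) =
      normalForm (m + (Finsupp.single e 1 + Finsupp.single f 1 + Finsupp.single x 1)) := by
  ext a
  cases a <;> simp [normalForm] <;> grind

lemma normalForm_eq_self {m : Pentagon →₀ ℕ} (h1 : m x = 0 ∨ m z = 0) (h2 : m y = 0 ∨ m z = 0)
    (h3 : m e = 0 ∨ m f = 0 ∨ m y = 0) : normalForm m = m := by
  ext a
  cases a <;> simp [normalForm] <;> grind

lemma divX_normalForm (m : Pentagon →₀ ℕ) :
    divX (normalForm (m + Finsupp.single x 1)) = normalForm m := by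
  ext a
  cases a <;> simp [divX, normalForm] <;> grind

lemma mapExponents_normalForm_eq_zero {p : MvPolynomial Pentagon K}
    (hp : p ∈ joinMeetIdeal K Pentagon) : mapExponents K normalForm p = 0 := by
  suffices ∀ q, mapExponents K normalForm (q * p) = 0 by simpa using this 1
  rw [joinMeetIdeal_eq] at hp
  refine Submodule.span_induction ?_ (by simp)
    (fun p q _ _ h h' r => by rw [mul_add, map_add, h, h', add_zero])
    (fun c p _ h q => by rw [smul_eq_mul, ← mul_assoc, h]) hp
  rintro _ (rfl | rfl) q <;>
  induction q using MvPolynomial.induction_on' with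
  | monomial m c =>
    simp only [X, monomial_mul, mul_sub, map_sub, mapExponents_monomial, normalForm_xz,
      normalForm_yz, sub_self, mul_one]
  | add p q hp hq => rw [add_mul, map_add, hp, hq, add_zero]

/-- Each rewriting rule holds in `H[P]` and lowers `m y + m z`. -/
lemma mk_monomial_normalForm (m : Pentagon →₀ ℕ) :
    Ideal.Quotient.mk (joinMeetIdeal K Pentagon) (monomial m 1) =
      Ideal.Quotient.mk (joinMeetIdeal K Pentagon) (monomial (normalForm m) 1) := by
  have hxz : latticeVar K x * latticeVar K z = latticeVar K f * latticeVar K e :=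
    LatticeAlgebra.latticeVar_mul x z
  have hyz : latticeVar K y * latticeVar K z = latticeVar K f * latticeVar K e :=
    LatticeAlgebra.latticeVar_mul y z
  have hefy : latticeVar K e * latticeVar K f * latticeVar K y =
      latticeVar K e * latticeVar K f * latticeVar K x := by
    linear_combination latticeVar K x * hyz - latticeVar K y * hxz
  have hmon : ∀ (m : Pentagon →₀ ℕ) (a : Pentagon),
      Ideal.Quotient.mk (joinMeetIdeal K Pentagon) (monomial (m + Finsupp.single a 1) 1) =
        Ideal.Quotient.mk (joinMeetIdeal K Pentagon) (monomial m 1) * latticeVar K a := by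
    intro m a
    rw [latticeVar, ← map_mul, X, monomial_mul, one_mul]
  induction hn : m y + m z using Nat.strong_induction_on generalizing m with
  | _ n ih =>
    subst hn
    by_cases h1 : 0 < m x ∧ 0 < m z
    · obtain ⟨m, rfl⟩ := exists_add_of_le
        ((single_add_single_le_iff (by simp : x ≠ z)).2 ⟨h1.1, h1.2⟩)
      rw [add_comm, normalForm_xz, ← ih _ ?_ _ rfl]
      · simp only [← add_assoc, hmon]
        linear_combination Ideal.Quotient.mk (joinMeetIdeal K Pentagon) (monomial m 1) * hxz
      · simp
    by_cases h2 : 0 < m y ∧ 0 < m z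
    · obtain ⟨m, rfl⟩ := exists_add_of_le
        ((single_add_single_le_iff (by simp : y ≠ z)).2 ⟨h2.1, h2.2⟩)
      rw [add_comm, normalForm_yz, ← ih _ ?_ _ rfl]
      · simp only [← add_assoc, hmon]
        linear_combination Ideal.Quotient.mk (joinMeetIdeal K Pentagon) (monomial m 1) * hyz
      · simp
        omega
    by_cases h3 : 0 < m e ∧ 0 < m f ∧ 0 < m y
    · have hle : Finsupp.single e 1 + Finsupp.single f 1 + Finsupp.single y 1 ≤ m := fun a => by
        cases a <;> simp <;> omega
      obtain ⟨m, rfl⟩ := exists_add_of_le hle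
      rw [add_comm, normalForm_efy, ← ih _ ?_ _ rfl]
      · simp only [← add_assoc, hmon]
        linear_combination Ideal.Quotient.mk (joinMeetIdeal K Pentagon) (monomial m 1) * hefy
      · simp
    · rw [normalForm_eq_self] <;> omega

lemma mk_mapExponents_normalForm (p : MvPolynomial Pentagon K) :
    Ideal.Quotient.mk (joinMeetIdeal K Pentagon) (mapExponents K normalForm p) =
      Ideal.Quotient.mk (joinMeetIdeal K Pentagon) p := by
  induction p using MvPolynomial.induction_on' with
  | monomial m c =>
    rw [mapExponents_monomial, ← mul_one c, ← C_mul_monomial, map_mul, ← mk_monomial_normalForm,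
      ← map_mul, C_mul_monomial]
  | add p q hp hq => rw [map_add, map_add, map_add, hp, hq]

/-- The variable `x` is a nonzerodivisor of `H[P]`: on normal forms, multiplication by `x` is
injective. -/
lemma eq_zero_of_mul_latticeVar_x {g : LatticeAlgebra K Pentagon} (hg : g * latticeVar K x = 0) :
    g = 0 := by
  obtain ⟨p, rfl⟩ := Ideal.Quotient.mk_surjective g
  rw [latticeVar, ← map_mul, Ideal.Quotient.eq_zero_iff_mem] at hg
  have h := mapExponents_normalForm_eq_zero hg
  rw [X, ← mapExponents_add, mapExponents_mapExponents] at h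
  have h' := congrArg (mapExponents K divX) h
  rw [mapExponents_mapExponents, map_zero] at h'
  have : divX ∘ normalForm ∘ (· + Finsupp.single x 1) = normalForm := funext divX_normalForm
  rw [this] at h'
  rw [← mk_mapExponents_normalForm, h', map_zero]

/-- Modulo `x` the relations of `H[P]` become `e f = 0` and `y z = 0`; these are the exponents of
the generators of the resulting monomial ideal together with the variables in `T`. -/
def monomialGenerators (T : Set Pentagon) : Set (Pentagon →₀ ℕ) :=
  (fun a => Finsupp.single a 1) '' T ∪
    {Finsupp.single e 1 + Finsupp.single f 1, Finsupp.single y 1 + Finsupp.single z 1}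

lemma exists_monomialGenerators_le_iff {T : Set Pentagon} {m : Pentagon →₀ ℕ} :
    (∃ s ∈ monomialGenerators T, s ≤ m) ↔
      (∃ t ∈ T, 1 ≤ m t) ∨ (1 ≤ m e ∧ 1 ≤ m f) ∨ (1 ≤ m y ∧ 1 ≤ m z) := by
  rw [← single_add_single_le_iff (by simp : e ≠ f), ← single_add_single_le_iff (by simp : y ≠ z)]
  simp only [monomialGenerators, Set.mem_union, Set.mem_image, Set.mem_insert_iff,
    Set.mem_singleton_iff, or_and_right, exists_or, exists_eq_left, exists_exists_and_eq_and,
    Finsupp.single_le_iff]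

lemma mk_mem_varIdeal_iff {T : Set Pentagon} (hT : x ∈ T) (p : MvPolynomial Pentagon K) :
    Ideal.Quotient.mk (joinMeetIdeal K Pentagon) p ∈ varIdeal K T ↔
      ∀ m ∈ p.support, ∃ s ∈ monomialGenerators T, s ≤ m := by
  rw [← mem_ideal_span_monomial_image, varIdeal]
  set N : Ideal (MvPolynomial Pentagon K) :=
    Ideal.span ((fun s => monomial s 1) '' monomialGenerators T) with hN
  have hX : ∀ a ∈ T, X a ∈ N := fun a ha => Ideal.subset_span ⟨_, Or.inl ⟨a, ha, rfl⟩, rfl⟩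
  have hef : X f * X e ∈ N := Ideal.subset_span
    ⟨_, Or.inr (Or.inl rfl), by simp [X, monomial_mul, add_comm]⟩
  have hyz : X y * X z ∈ N := Ideal.subset_span
    ⟨_, Or.inr (Or.inr rfl), by simp [X, monomial_mul]⟩
  have hxmul : ∀ q : LatticeAlgebra K Pentagon,
      latticeVar K x * q ∈ Ideal.span (latticeVar K '' T) := fun q =>
    Ideal.mul_mem_right _ _ (LatticeAlgebra.latticeVar_mem_varIdeal hT)
  have hxz : latticeVar K x * latticeVar K z = latticeVar K f * latticeVar K e :=
    LatticeAlgebra.latticeVar_mul x z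
  have hyz' : latticeVar K y * latticeVar K z = latticeVar K f * latticeVar K e :=
    LatticeAlgebra.latticeVar_mul y z
  constructor
  · intro h
    have himg : latticeVar K '' T = Ideal.Quotient.mk (joinMeetIdeal K Pentagon) '' (X '' T) := by
      rw [← Set.image_comp]; rfl
    rw [himg, ← Ideal.map_span, Ideal.mem_quotient_iff_mem_sup] at h
    refine (sup_le (Ideal.span_le.2 ?_) ?_ : _ ≤ N) h
    · rintro _ ⟨a, ha, rfl⟩
      exact hX a ha
    · rw [joinMeetIdeal_eq, Ideal.span_le]
      rintro _ (rfl | rfl)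
      · exact sub_mem (Ideal.mul_mem_right _ _ (hX x hT)) hef
      · exact sub_mem hyz hef
  · intro h
    have : N ≤ (Ideal.span (latticeVar K '' T)).comap
        (Ideal.Quotient.mk (joinMeetIdeal K Pentagon)) := by
      refine Ideal.span_le.2 ?_
      rintro _ ⟨_, ⟨a, ha, rfl⟩ | rfl | rfl, rfl⟩
      · exact LatticeAlgebra.latticeVar_mem_varIdeal ha
      · dsimp only
        rw [SetLike.mem_coe, Ideal.mem_comap, ← one_mul (1 : K), ← monomial_mul, map_mul]
        change latticeVar K e * latticeVar K f ∈ _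
        rw [mul_comm, ← hxz]
        exact hxmul _
      · dsimp only
        rw [SetLike.mem_coe, Ideal.mem_comap, ← one_mul (1 : K), ← monomial_mul, map_mul]
        change latticeVar K y * latticeVar K z ∈ _
        rw [hyz', ← hxz]
        exact hxmul _
    exact this h

/-- The involution that matches the two factors of `e f` and of `y z`. -/
def partner : Pentagon → Pentagon
  | e => f
  | x => x
  | y => z
  | z => y
  | f => e

lemma mul_latticeVar_mem_varIdeal_iff {T : Set Pentagon} (hT : x ∈ T) {a : Pentagon} (ha : a ∉ T)
    (g : LatticeAlgebra K Pentagon) :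
    g * latticeVar K a ∈ varIdeal K T ↔ g ∈ varIdeal K (insert (partner a) T) := by
  obtain ⟨p, rfl⟩ := Ideal.Quotient.mk_surjective g
  have hax : a ≠ x := fun h => ha (h ▸ hT)
  rw [latticeVar, ← map_mul, mk_mem_varIdeal_iff hT, mk_mem_varIdeal_iff (Or.inr hT)]
  simp only [support_mul_X, Finset.mem_map, addRightEmbedding_apply, forall_exists_index, and_imp,
    forall_apply_eq_imp_iff₂]
  refine forall₂_congr fun m _ => ?_
  have hT' : (∃ t ∈ T, 1 ≤ (m + Finsupp.single a 1 : Pentagon →₀ ℕ) t) ↔ ∃ t ∈ T, 1 ≤ m t := by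
    refine exists_congr fun t => and_congr_right fun ht => ?_
    rw [Finsupp.add_apply, Finsupp.single_apply, if_neg (fun h : a = t => ha (h ▸ ht)), add_zero]
  have hins : (∃ t ∈ insert (partner a) T, 1 ≤ m t) ↔ 1 ≤ m (partner a) ∨ ∃ t ∈ T, 1 ≤ m t := by
    simp only [Set.mem_insert_iff, or_and_right, exists_or, exists_eq_left]
  rw [exists_monomialGenerators_le_iff, exists_monomialGenerators_le_iff, hT', hins]
  generalize (∃ t ∈ T, 1 ≤ m t) = Q
  cases a
  case x => exact absurd rfl hax
  all_goals
    simp [partner]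
    tauto

lemma exists_filtration :
    ∃ F : Set (Ideal (LatticeAlgebra K Pentagon)), IsCombinatorialKoszulFiltration K F := by
  refine ⟨_, LatticeAlgebra.isCombinatorialKoszulFiltration_of_sets {S | S = ∅ ∨ x ∈ S}
    (Or.inl rfl) (Or.inr trivial) ?_⟩
  rintro S (rfl | hS) hne
  · exact absurd hne Set.not_nonempty_empty
  by_cases h : ∃ a ∈ S, a ≠ x
  · obtain ⟨a, ha, hax⟩ := h
    have hx : x ∈ S \ {a} := ⟨hS, hax.symm⟩
    exact ⟨a, S \ {a}, Or.inr hx, _, Or.inr (Or.inr hx), by simp,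
      by simp [Set.insert_eq_of_mem ha], mul_latticeVar_mem_varIdeal_iff hx (by simp)⟩
  · push Not at h
    refine ⟨x, ∅, Or.inl rfl, ∅, Or.inl rfl, by simp, ?_, fun g => ?_⟩
    · exact Set.ext fun a => ⟨fun ha => Or.inl (h a ha), by rintro (rfl | ⟨⟨⟩⟩); exact hS⟩
    · rw [LatticeAlgebra.varIdeal_empty, Ideal.mem_bot, Ideal.mem_bot]
      exact ⟨eq_zero_of_mul_latticeVar_x, fun h => by rw [h, zero_mul]⟩

end Pentagon

theorem theorem2p4 (K : Type*) [Field K] :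
    (∀ (L : Type*) [Lattice L] [Finite L] [IsModularLattice L],
      IsDistributiveLattice L ↔
        ∃ F : Set (Ideal (LatticeAlgebra K L)), IsCombinatorialKoszulFiltration K F) ∧
    (¬ IsDistributiveLattice Pentagon ∧
      ∃ F : Set (Ideal (LatticeAlgebra K Pentagon)), IsCombinatorialKoszulFiltration K F) :=
  ⟨fun _ _ _ _ => ⟨LatticeAlgebra.exists_filtration_of_distributive,
      fun ⟨_, hF⟩ => LatticeAlgebra.isDistributiveLattice_of_filtration hF⟩,
    Pentagon.not_isDistributiveLattice, Pentagon.exists_filtration⟩
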